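/- Let $X\sim\mathcal N(0,\Sigma_X)$ be a Gaussian vector in $\mathbb R^L$, $L\ge 1$, with $\Sigma_X\succ 0$ and $\Sigma_X=\Theta^T\operatorname{diag}(\lambda_1,\dots,\lambda_L)\Theta$, $\Theta$ orthogonal. For $D\ge 0$ and $P\in[0,\infty]$ let $$R(D,P)=\inf I(X;\hat X),$$ the infimum (in nats) being over all conditional distributions $P_{\hat X|X}$ on $\mathbb R^L$ with $\mathbb E\|X-\hat X\|^2\le D$ and $\phi(P_X,P_{\hat X})\le P$, where the perception loss $\phi$ is either the KL divergence $D(P_{\hat X}\|P_X)$ or the squared Wasserstein-2 distance $W_2^2(P_X,P_{\hat X})$; $P=\infty$ means that there is no perception constraint. Let $\lambda^{\max}=\max_\ell\lambda_\ell$ and $\mathcal L^{\max}=\{\ell:\lambda_\ell=\lambda^{\max}\}$. For a distortion $D$ let $\nu(D)$ be the solution of $$\sum_{\ell=1}^L[\lambda_\ell-\nu(D)]^+=\Big[\sum_{\ell=1}^L\lambda_\ell-D\Big]^+,\qquad [x]^+=\max\{0,x\},$$ and let $\gamma^*_\ell(D,\infty)=\lambda_\ell$ if $\nu(D)\ge\lambda_\ell$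 and $\gamma^*_\ell(D,\infty)=\nu(D)$ if $\nu(D)<\lambda_\ell$; the rate allocated to component $\ell$ is $\frac12\log\frac{\lambda_\ell}{\gamma^*_\ell(D,\infty)}$. Then $R\big(\sum_\ell\lambda_\ell-\epsilon,\infty\big)$ is finite for all sufficiently small $\epsilon>0$, and as $\epsilon\downarrow 0$ $$R\Big(\sum_{\ell=1}^L\lambda_\ell-\epsilon,\infty\Big)=\frac{\epsilon}{2\lambda^{\max}}+O(\epsilon^2).$$ Moreover, for all sufficiently small $\epsilon>0$, the solution $\nu\big(\sum_\ell\lambda_\ell-\epsilon\big)$ exists and is unique, and the water levels are $$\gamma^*_\ell\Big(\sum_{k}\lambda_k-\epsilon,\infty\Big)=\lambda_\ell\quad(\ell\notin\mathcal L^{\max}),\qquad \gamma^*_\ell\Big(\sum_{k}\lambda_k-\epsilon,\infty\Big)=\lambda^{\max}-\frac{\epsilon}{|\mathcal L^{\max}|}\quad(\ell\in\mathcal L^{\max}),$$ so that the components $\ell\notin\mathcal L^{\max}$ are allocated zero rate and the components $\ell\in\mathcal L^{\max}$ positive rate. -/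

import Mathlib

open MeasureTheory ProbabilityTheory InformationTheory Filter Asymptotics
open scoped ENNReal Topology

namespace GaussianRDP

noncomputable section

/-- Mutual information `I(X; X̂)`, in nats, when `X ∼ μ` and the conditional distribution of `X̂`
given `X` is `κ`: the divergence of the joint law of `(X, X̂)` from the product of its marginals. -/
def mutualInfo {E : Type*} [MeasurableSpace E] (μ : Measure E) (κ : Kernel E E) : ℝ≥0∞ :=
  klDiv (μ ⊗ₘ κ) (μ.prod (κ ∘ₘ μ))

/-- Expected squared-error distortion `𝔼[‖X - X̂‖²]` when `X ∼ μ` and `X̂ | X ∼ κ`. -/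
def distortion {E : Type*} [MeasurableSpace E] [NormedAddCommGroup E]
    (μ : Measure E) (κ : Kernel E E) : ℝ≥0∞ :=
  ∫⁻ p, ‖p.1 - p.2‖ₑ ^ 2 ∂(μ ⊗ₘ κ)

/-- Squared Wasserstein-2 distance: infimum of `𝔼[‖X - X̂‖²]` over all couplings. -/
def sqWasserstein {E : Type*} [MeasurableSpace E] [NormedAddCommGroup E]
    (μ ν : Measure E) : ℝ≥0∞ :=
  ⨅ (π : Measure (E × E)) (_ : π.fst = μ ∧ π.snd = ν), ∫⁻ p, ‖p.1 - p.2‖ₑ ^ 2 ∂π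

/-- The two perception metrics. -/
inductive Perception
  | kl
  | wasserstein

/-- The perception loss `φ(P_X, P_X̂)`: either `D(P_X̂ ‖ P_X)` or `W₂²(P_X, P_X̂)`. -/
def Perception.loss {E : Type*} [MeasurableSpace E] [NormedAddCommGroup E] :
    Perception → Measure E → Measure E → ℝ≥0∞
  | .kl, μ, ν => klDiv ν μ
  | .wasserstein, μ, ν => sqWasserstein μ ν

/-- The information rate-distortion-perception function `R(D, P)` of a source with law `μ`: the
infimum of the mutual information over all conditional distributions (Markov kernels) that meet
the distortion and the perception constraint. The infimum over no kernel is `∞`, and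
`P = ∞` means that there is no perception constraint. -/
def rdp {E : Type*} [MeasurableSpace E] [NormedAddCommGroup E]
    (φ : Perception) (μ : Measure E) (D P : ℝ≥0∞) : ℝ≥0∞ :=
  ⨅ (κ : Kernel E E)
    (_ : IsMarkovKernel κ ∧ distortion μ κ ≤ D ∧ φ.loss μ (κ ∘ₘ μ) ≤ P), mutualInfo μ κ

/-- `ν` solves the reverse water-filling equation `∑ [λ_ℓ - ν]⁺ = [∑ λ_ℓ - D]⁺`. -/
def IsWaterLevel {L : ℕ} (lam : Fin L → ℝ) (D ν : ℝ) : Prop :=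
  ∑ l, max 0 (lam l - ν) = max 0 ((∑ l, lam l) - D)

/-- The water level `γ_ℓ` of a component of variance `lam`, given the common level `ν`. -/
def compLevel (lam ν : ℝ) : ℝ := if lam ≤ ν then lam else ν

/-- The rate `(1/2) log (λ_ℓ / γ_ℓ)` allocated to a component of variance `lam` with water
level `γ`. -/
def compRate (lam γ : ℝ) : ℝ := (1 / 2) * Real.log (lam / γ)

/-- The largest eigenvalue. -/
def lamMax {L : ℕ} (lam : Fin L → ℝ) : ℝ := ⨆ l, lam l

/-- The set of indices whose eigenvalue is the largest one. -/
def maxIdx {L : ℕ} (lam : Fin L → ℝ) : Finset (Fin L) :=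
  Finset.univ.filter fun l => lam l = lamMax lam

end

end GaussianRDP

/-! The rate is squeezed between two bounds that agree to first order. Below, Donsker–Varadhan is
applied to the joint law against the product of its marginals, with test function `(‖x‖² - ‖x - y‖²)
/ (2 λmax)`. Its exponential has mean at most 1 under the product, because `⟨y, X⟩` is Gaussian of
variance at most `λmax ‖y‖²`. Its mean under the joint law is at least `ε / (2 λmax)`
(`le_mutualInfo`).

Above, a single top eigenvector is compressed through the backward Gaussian channel, all else being
reproduced as 0 (`exists_kernel_mutualInfo_eq`). This costs `(1/2) log (λmax / (λmax - ε))`. Using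
one direction rather than sharing among all maximal ones changes the rate only by `O(ε²)`, so
optimality of water-filling is never needed.

The water levels are a separate calculation: an explicit level is checked, and strict monotonicity
makes it unique. -/

namespace GaussianRDP

/-! ### Divergence: variational lower bound and exact value -/

section Divergence

variable {α : Type*} [MeasurableSpace α]

/-- Donsker–Varadhan lower bound on the divergence, for a normalized exponential. -/
theorem ofReal_integral_le_klDiv {P Q : Measure α} [IsProbabilityMeasure P]
    [IsProbabilityMeasure Q] {f : α → ℝ} (hf : Measurable f) (hfP : Integrable f P)
    (hexp : ∫⁻ x, ENNReal.ofReal (Real.exp (f x)) ∂Q ≤ 1) :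
    ENNReal.ofReal (∫ x, f x ∂P) ≤ klDiv P Q := by
  by_cases htop : klDiv P Q = ⊤
  · simp [htop]
  obtain ⟨hac, hint⟩ := klDiv_ne_top_iff.1 htop
  rw [klDiv_of_ac_of_integrable hac hint]
  refine ENNReal.ofReal_le_ofReal ?_
  simp only [probReal_univ, add_sub_cancel_right]
  -- `exp (-llr)` is `dQ/dP`, so this changes measure from `P` to the part of `Q` absolutely
  -- continuous with respect to `P`; hence only an inequality.
  have hlint : ∫⁻ x, ENNReal.ofReal (Real.exp (f x - llr P Q x)) ∂P ≤ 1 := by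
    calc ∫⁻ x, ENNReal.ofReal (Real.exp (f x - llr P Q x)) ∂P
        ≤ ∫⁻ x, (Q.rnDeriv P * fun x => ENNReal.ofReal (Real.exp (f x))) x ∂P := by
          refine lintegral_mono_ae ?_
          filter_upwards [exp_neg_llr hac] with x hx
          rw [sub_eq_add_neg, Real.exp_add, hx, ENNReal.ofReal_mul (Real.exp_pos _).le, mul_comm]
          exact mul_le_mul_left ENNReal.ofReal_toReal_le _
      _ = ∫⁻ x, ENNReal.ofReal (Real.exp (f x)) ∂(P.withDensity (Q.rnDeriv P)) :=
          (lintegral_withDensity_eq_lintegral_mul _ (Measure.measurable_rnDeriv _ _)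
            (by fun_prop)).symm
      _ ≤ ∫⁻ x, ENNReal.ofReal (Real.exp (f x)) ∂Q :=
          lintegral_mono' (Measure.withDensity_rnDeriv_le _ _) le_rfl
      _ ≤ 1 := hexp
  have hmeas : Measurable fun x => Real.exp (f x - llr P Q x) :=
    (hf.sub (measurable_llr P Q)).exp
  have hi : Integrable (fun x => Real.exp (f x - llr P Q x)) P :=
    ⟨hmeas.aestronglyMeasurable, by
      rw [hasFiniteIntegral_iff_ofReal (ae_of_all _ fun x => (Real.exp_pos _).le)]
      exact hlint.trans_lt ENNReal.one_lt_top⟩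
  have h1 : ∫ x, Real.exp (f x - llr P Q x) ∂P ≤ 1 := by
    rw [integral_eq_lintegral_of_nonneg_ae (ae_of_all _ fun x => (Real.exp_pos _).le)
      hmeas.aestronglyMeasurable]
    exact ENNReal.toReal_le_of_le_ofReal zero_le_one (by simpa using hlint)
  -- `t + 1 ≤ exp t` takes the place of Jensen's inequality.
  have h2 : ∫ x, (f x - llr P Q x) ∂P ≤ ∫ x, (Real.exp (f x - llr P Q x) - 1) ∂P :=
    integral_mono (hfP.sub hint) (hi.sub (integrable_const 1)) fun x => by
      have := Real.add_one_le_exp (f x - llr P Q x)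
      simp only; linarith
  rw [integral_sub hfP hint, integral_sub hi (integrable_const 1)] at h2
  simp only [integral_const, probReal_univ, smul_eq_mul, mul_one] at h2
  linarith

theorem klDiv_withDensity_exp {P Q : Measure α} [IsProbabilityMeasure P] [IsProbabilityMeasure Q]
    {g : α → ℝ} (hg : Measurable g)
    (hP : P = Q.withDensity fun x => ENNReal.ofReal (Real.exp (g x))) (hgP : Integrable g P) :
    klDiv P Q = ENNReal.ofReal (∫ x, g x ∂P) := by
  have hac : P ≪ Q := hP ▸ withDensity_absolutelyContinuous _ _
  have hllr : llr P Q =ᵐ[P] g := by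
    refine hac.ae_le ?_
    have := Measure.rnDeriv_withDensity Q
      (f := fun x => ENNReal.ofReal (Real.exp (g x))) (by fun_prop)
    rw [← hP] at this
    filter_upwards [this] with x hx
    rw [llr, hx, ENNReal.toReal_ofReal (Real.exp_pos _).le, Real.log_exp]
  rw [klDiv_of_ac_of_integrable hac (hgP.congr hllr.symm), integral_congr_ae hllr]
  simp

end Divergence

/-! ### The scalar backward Gaussian channel -/

section RealGaussian

open NNReal

/-- The log-density of the joint law of `(Y + Z, Y)` with respect to the product of its marginals,
for independent centred Gaussians `Y` and `Z` of variances `a` and `b`. -/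
noncomputable def logDensity (a b : ℝ≥0) (u y : ℝ) : ℝ :=
  1 / 2 * Real.log ((a + b) / b) + u ^ 2 / (2 * (a + b)) - (u - y) ^ 2 / (2 * b)

theorem measurable_logDensity (a b : ℝ≥0) :
    Measurable fun p : ℝ × ℝ => logDensity a b p.1 p.2 := by
  unfold logDensity; fun_prop

theorem exp_half_log {r : ℝ} (hr : 0 < r) : Real.exp (1 / 2 * Real.log r) = √r := by
  rw [Real.sqrt_eq_rpow, Real.rpow_def_of_pos hr, mul_comm]

theorem exp_logDensity {a b : ℝ≥0} (ha : 0 < a) (hb : 0 < b) (u y : ℝ) :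
    Real.exp (logDensity a b u y) = √((a + b) / b) *
      Real.exp (u ^ 2 / (2 * (a + b)) - (u - y) ^ 2 / (2 * b)) := by
  have ha' : (0 : ℝ) < a := ha
  have hb' : (0 : ℝ) < b := hb
  rw [logDensity, add_sub_assoc, Real.exp_add, exp_half_log (by positivity)]

/-- Bayes' rule: joint density ratio times the marginal of `U = Y + Z` is the law of `U` given `Y =
y`. -/
theorem exp_logDensity_mul_left {a b : ℝ≥0} (ha : 0 < a) (hb : 0 < b) (u y : ℝ) :
    ENNReal.ofReal (Real.exp (logDensity a b u y)) * gaussianPDF 0 (a + b) u =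
      gaussianPDF y b u := by
  have ha' : (0 : ℝ) < a := ha
  have hb' : (0 : ℝ) < b := hb
  rw [gaussianPDF, gaussianPDF, ← ENNReal.ofReal_mul (Real.exp_pos _).le, exp_logDensity ha hb,
    gaussianPDFReal, gaussianPDFReal, mul_mul_mul_comm, ← Real.exp_add]
  congr 2
  · rw [← Real.sqrt_inv, ← Real.sqrt_inv, ← Real.sqrt_mul (by positivity)]
    congr 1
    push_cast
    field_simp
  · congr 1
    push_cast
    field_simp
    ring

/-- The other conditional: the posterior of `Y` given `U = u`, obtained by completing the square in
`y`. Its total mass 1 makes the test channel Markov. -/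
theorem exp_logDensity_mul_right {a b : ℝ≥0} (ha : 0 < a) (hb : 0 < b) (u y : ℝ) :
    ENNReal.ofReal (Real.exp (logDensity a b u y)) * gaussianPDF 0 a y =
      gaussianPDF (a / (a + b) * u) (a * b / (a + b)) y := by
  have ha' : (0 : ℝ) < a := ha
  have hb' : (0 : ℝ) < b := hb
  rw [gaussianPDF, gaussianPDF, ← ENNReal.ofReal_mul (Real.exp_pos _).le, exp_logDensity ha hb,
    gaussianPDFReal, gaussianPDFReal, mul_mul_mul_comm, ← Real.exp_add]
  congr 2
  · rw [← Real.sqrt_inv, ← Real.sqrt_inv, ← Real.sqrt_mul (by positivity)]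
    congr 1
    push_cast
    field_simp
  · congr 1
    push_cast
    field_simp
    ring

theorem lintegral_exp_logDensity_mul {a b : ℝ≥0} (ha : 0 < a) (hb : 0 < b) (y : ℝ)
    {G : ℝ → ℝ≥0∞} (hG : Measurable G) :
    ∫⁻ u, ENNReal.ofReal (Real.exp (logDensity a b u y)) * G u ∂(gaussianReal 0 (a + b)) =
      ∫⁻ u, G u ∂(gaussianReal y b) := by
  have hm : Measurable fun u => logDensity a b u y := by unfold logDensity; fun_prop
  rw [gaussianReal_of_var_ne_zero _ hb.ne', gaussianReal_of_var_ne_zero _ (by positivity),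
    lintegral_withDensity_eq_lintegral_mul _ (by fun_prop) (by fun_prop),
    lintegral_withDensity_eq_lintegral_mul _ (by fun_prop) hG]
  refine lintegral_congr fun u => ?_
  simp only [Pi.mul_apply]
  rw [← exp_logDensity_mul_left ha hb]
  ring

theorem lintegral_exp_logDensity_right {a b : ℝ≥0} (ha : 0 < a) (hb : 0 < b) (u : ℝ) :
    ∫⁻ y, ENNReal.ofReal (Real.exp (logDensity a b u y)) ∂(gaussianReal 0 a) = 1 := by
  have hm : Measurable fun y => logDensity a b u y := by unfold logDensity; fun_prop
  rw [gaussianReal_of_var_ne_zero _ ha.ne',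
    lintegral_withDensity_eq_lintegral_mul _ (by fun_prop) (by fun_prop),
    ← lintegral_gaussianPDF_eq_one (a / (a + b) * u) (v := a * b / (a + b)) (by positivity)]
  refine lintegral_congr fun y => ?_
  simp only [Pi.mul_apply]
  rw [← exp_logDensity_mul_right ha hb, mul_comm]

theorem integrable_sq_sub_gaussianReal (m c : ℝ) (v : ℝ≥0) :
    Integrable (fun u => (u - c) ^ 2) (gaussianReal m v) :=
  (((memLp_id_gaussianReal 2 : MemLp id 2 (gaussianReal m v))).sub
    (memLp_const c)).integrable_sq

theorem integral_sq_sub_gaussianReal (m : ℝ) (v : ℝ≥0) :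
    ∫ u, (u - m) ^ 2 ∂(gaussianReal m v) = v := by
  have h := variance_eq_integral (X := id) (μ := gaussianReal m v) aemeasurable_id
  rw [variance_id_gaussianReal] at h
  simpa using h.symm

theorem lintegral_sq_sub_gaussianReal (m : ℝ) (v : ℝ≥0) :
    ∫⁻ u, ENNReal.ofReal ((u - m) ^ 2) ∂(gaussianReal m v) = v := by
  rw [← ofReal_integral_eq_lintegral_ofReal (integrable_sq_sub_gaussianReal m m v)
    (ae_of_all _ fun u => sq_nonneg _), integral_sq_sub_gaussianReal, ENNReal.ofReal_coe_nnreal]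

end RealGaussian

/-! ### Lower bound on the rate, and a channel nearly attaining it -/

section Bounds

theorem distortion_eq {E : Type*} [NormedAddCommGroup E] [MeasurableSpace E] (μ : Measure E)
    (κ : Kernel E E) :
    distortion μ κ = ∫⁻ p, ENNReal.ofReal (‖p.1 - p.2‖ ^ 2) ∂(μ ⊗ₘ κ) := by
  refine lintegral_congr fun p => ?_
  rw [ENNReal.ofReal_pow (norm_nonneg _), ofReal_norm]

theorem integrable_comp_fst {α : Type*} [MeasurableSpace α] {μ : Measure α} [SFinite μ]
    (κ : Kernel α α) [IsMarkovKernel κ] {F : α → ℝ} (hF : Integrable F μ) :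
    Integrable (fun p : α × α => F p.1) (μ ⊗ₘ κ) := by
  rw [← Measure.fst_compProd μ κ] at hF
  exact hF.comp_measurable measurable_fst

theorem integral_comp_fst {α : Type*} [MeasurableSpace α] {μ : Measure α} [SFinite μ]
    (κ : Kernel α α) [IsMarkovKernel κ] {F : α → ℝ} (hF : Measurable F) :
    ∫ p, F p.1 ∂(μ ⊗ₘ κ) = ∫ x, F x ∂μ := by
  conv_rhs => rw [← Measure.fst_compProd μ κ, Measure.fst, integral_map (by fun_prop)
    hF.aestronglyMeasurable]

variable {E : Type*} [NormedAddCommGroup E] [InnerProductSpace ℝ E] [MeasurableSpace E]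
  [BorelSpace E] [SecondCountableTopology E]

open NNReal

theorem lintegral_comp_inner {μ : Measure E} {v : E} {ρ : Measure ℝ}
    (h : μ.map (fun x => inner ℝ v x) = ρ) {G : ℝ → ℝ≥0∞} (hG : Measurable G) :
    ∫⁻ x, G (inner ℝ v x) ∂μ = ∫⁻ u, G u ∂ρ := by
  rw [← h, lintegral_map hG (by fun_prop)]

/-- A source whose one-dimensional projections are Gaussian, with variances dominated by
`lam ‖y‖²`, has a rate of at least `(𝔼‖X‖² - D) / (2 lam)` at distortion `D`. -/
theorem le_mutualInfo {μ : Measure E} [IsProbabilityMeasure μ] {q : E → ℝ≥0} {lam T D : ℝ}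
    (hlam : 0 < lam) (hD : 0 ≤ D)
    (hμ : ∀ y, μ.map (fun x => inner ℝ y x) = gaussianReal 0 (q y))
    (hq : ∀ y, q y ≤ lam * ‖y‖ ^ 2) (hT : Integrable (fun x => ‖x‖ ^ 2) μ)
    (hTe : ∫ x, ‖x‖ ^ 2 ∂μ = T) (κ : Kernel E E) [IsMarkovKernel κ]
    (hdist : distortion μ κ ≤ ENNReal.ofReal D) :
    ENNReal.ofReal ((T - D) / (2 * lam)) ≤ mutualInfo μ κ := by
  rw [distortion_eq] at hdist
  have hx := integrable_comp_fst κ hT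
  have hxe := (integral_comp_fst (μ := μ) κ (F := fun x => ‖x‖ ^ 2) (by fun_prop)).trans hTe
  have hd : Integrable (fun p : E × E => ‖p.1 - p.2‖ ^ 2) (μ ⊗ₘ κ) :=
    ⟨by fun_prop, by
      rw [hasFiniteIntegral_iff_ofReal (ae_of_all _ fun x => sq_nonneg _)]
      exact hdist.trans_lt ENNReal.ofReal_lt_top⟩
  have hde : ∫ p, ‖p.1 - p.2‖ ^ 2 ∂(μ ⊗ₘ κ) ≤ D := by
    rw [integral_eq_lintegral_of_nonneg_ae (ae_of_all _ fun x => sq_nonneg _) (by fun_prop)]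
    exact ENNReal.toReal_le_of_le_ofReal hD hdist
  have hfi := (hx.sub hd).div_const (2 * lam)
  have hexp : ∫⁻ p, ENNReal.ofReal (Real.exp ((‖p.1‖ ^ 2 - ‖p.1 - p.2‖ ^ 2) / (2 * lam)))
      ∂(μ.prod (κ ∘ₘ μ)) ≤ 1 := by
    rw [lintegral_prod_symm _ (by fun_prop)]
    calc _ ≤ ∫⁻ _, 1 ∂(κ ∘ₘ μ) := lintegral_mono fun y => ?_
      _ = 1 := by simp
    -- For fixed `y` the exponent is affine in `⟨y, x⟩`, so the integral over `x` is a Gaussian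
    -- moment generating function.
    have key : ∀ x : E, (‖x‖ ^ 2 - ‖x - y‖ ^ 2) / (2 * lam) =
        1 / lam * inner ℝ y x + -(‖y‖ ^ 2 / (2 * lam)) := fun x => by
      rw [norm_sub_sq_real, real_inner_comm]
      field_simp
      ring
    simp only [key, Real.exp_add]
    have hi : Integrable (fun x => Real.exp (1 / lam * inner ℝ y x)) μ := by
      have := integrable_exp_mul_gaussianReal (μ := 0) (v := q y) (1 / lam)
      rw [← hμ y] at this
      exact this.comp_measurable (by fun_prop)
    rw [← ofReal_integral_eq_lintegral_ofReal (hi.mul_const _)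
      (ae_of_all _ fun x => by positivity), integral_mul_const]
    have hm := mgf_gaussianReal (hμ y) (1 / lam)
    rw [mgf] at hm
    rw [hm, ← Real.exp_add, ENNReal.ofReal_le_one, Real.exp_le_one_iff]
    have : (q y : ℝ) * (1 / lam) ^ 2 / 2 ≤ ‖y‖ ^ 2 / (2 * lam) := by
      rw [show ‖y‖ ^ 2 / (2 * lam) = (lam * ‖y‖ ^ 2) * (1 / lam) ^ 2 / 2 by field_simp]
      gcongr
      exact hq y
    linarith
  refine le_trans (ENNReal.ofReal_le_ofReal ?_)
    (ofReal_integral_le_klDiv (by fun_prop) hfi hexp)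
  simp only [Pi.sub_apply]
  rw [integral_div, integral_sub hx hd, hxe]
  gcongr

/-- Compressing the component along a unit vector `v`, of variance `a + b`, to distortion `b`
costs the rate `log ((a + b) / b) / 2`. -/
theorem exists_kernel_mutualInfo_eq {μ : Measure E} [IsProbabilityMeasure μ] {v : E}
    (hv : ‖v‖ = 1) {a b : ℝ≥0} (ha : 0 < a) (hb : 0 < b)
    (hμ : μ.map (fun x => inner ℝ v x) = gaussianReal 0 (a + b)) {T : ℝ}
    (hT : Integrable (fun x => ‖x‖ ^ 2) μ) (hTe : ∫ x, ‖x‖ ^ 2 ∂μ = T) :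
    ∃ κ : Kernel E E, IsMarkovKernel κ ∧ distortion μ κ = ENNReal.ofReal (T - a) ∧
      mutualInfo μ κ = ENNReal.ofReal (1 / 2 * Real.log ((a + b) / b)) := by
  have hvv : ∀ y : ℝ, inner ℝ v (y • v) = y := fun y => by
    rw [real_inner_smul_right, real_inner_self_eq_norm_sq, hv]; simp
  have hmsmul : Measurable fun y : ℝ => y • v := by fun_prop
  let ν : Measure E := (gaussianReal 0 a).map fun y => y • v
  have : IsProbabilityMeasure ν := Measure.isProbabilityMeasure_map hmsmul.aemeasurable
  let g : E × E → ℝ := fun p => logDensity a b (inner ℝ v p.1) (inner ℝ v p.2)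
  have hg : Measurable g :=
    (measurable_logDensity a b).comp (f := fun p : E × E => (inner ℝ v p.1, inner ℝ v p.2))
      (by fun_prop)
  let h : E → E → ℝ≥0∞ := fun x z => ENNReal.ofReal (Real.exp (g (x, z)))
  have hh : Measurable (Function.uncurry h) := hg.exp.ennreal_ofReal
  -- Prescribing the density against the intended output law `ν` makes the log-likelihood ratio of
  -- joint to product equal to `g`, once the output marginal is shown to be `ν`.
  let κ : Kernel E E := (Kernel.const E ν).withDensity h
  have hκ : IsMarkovKernel κ := ⟨fun x => ⟨by
    rw [Kernel.withDensity_apply _ hh, withDensity_apply _ MeasurableSet.univ,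
      Measure.restrict_univ, Kernel.const_apply, lintegral_map (by fun_prop) hmsmul]
    simp only [h, g, hvv]
    exact lintegral_exp_logDensity_right ha hb _⟩⟩
  have hP : μ ⊗ₘ κ = (μ.prod ν).withDensity fun p => ENNReal.ofReal (Real.exp (g p)) := by
    rw [Measure.compProd_withDensity hh, Measure.compProd_const]
  -- Backward description: given output `z`, the component `⟨v, X⟩` is `N(⟨v, z⟩, b)`.
  have hPint : ∀ G : ℝ → E → ℝ≥0∞, Measurable (fun p : ℝ × E => G p.1 p.2) →
      ∫⁻ p, G (inner ℝ v p.1) p.2 ∂(μ ⊗ₘ κ) =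
        ∫⁻ z, ∫⁻ u, G u z ∂(gaussianReal (inner ℝ v z) b) ∂ν := fun G hG => by
    have hG' : Measurable fun p : E × E => G (inner ℝ v p.1) p.2 :=
      hG.comp (f := fun p : E × E => (inner ℝ v p.1, p.2)) (by fun_prop)
    rw [hP, lintegral_withDensity_eq_lintegral_mul _ (by fun_prop) hG',
      lintegral_prod_symm _ (by fun_prop)]
    refine lintegral_congr fun z => ?_
    have hGz : Measurable fun u => G u z := hG.comp (f := fun u => (u, z)) (by fun_prop)
    have hgz : Measurable fun u => logDensity a b u (inner ℝ v z) :=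
      (measurable_logDensity a b).comp (f := fun u : ℝ => (u, inner ℝ v z)) (by fun_prop)
    rw [← lintegral_exp_logDensity_mul ha hb _ hGz]
    exact lintegral_comp_inner hμ
      (G := fun u => ENNReal.ofReal (Real.exp (logDensity a b u (inner ℝ v z))) * G u z)
      (by fun_prop)
  have hsnd : κ ∘ₘ μ = ν := by
    ext s hs
    rw [← Measure.snd_compProd, Measure.snd_apply hs, ← lintegral_indicator_one
      (measurable_snd hs)]
    have := hPint (fun _ z => s.indicator 1 z)
      ((measurable_one.indicator hs).comp measurable_snd)
    refine this.trans ?_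
    simp [lintegral_indicator_one hs]
  have hline : ∀ᵐ p ∂(μ ⊗ₘ κ), p.2 = (inner ℝ v p.2 : ℝ) • v := by
    have hs : MeasurableSet {z : E | z = (inner ℝ v z : ℝ) • v} :=
      measurableSet_eq_fun (by fun_prop) (by fun_prop)
    have hν : ∀ᵐ z ∂ν, z = (inner ℝ v z : ℝ) • v := by
      rw [ae_map_iff hmsmul.aemeasurable hs]
      exact ae_of_all _ fun y => by rw [hvv]
    rw [← hsnd, ← Measure.snd_compProd] at hν
    exact ae_of_ae_map measurable_snd.aemeasurable hν
  have hTi := integrable_comp_fst κ hT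
  have hTe' := (integral_comp_fst (μ := μ) κ (F := fun x => ‖x‖ ^ 2) (by fun_prop)).trans hTe
  have hU : Integrable (fun x : E => (inner ℝ v x : ℝ) ^ 2) μ := by
    have := integrable_sq_sub_gaussianReal 0 0 (a + b)
    rw [← hμ, integrable_map_measure (by fun_prop) (by fun_prop)] at this
    simpa [Function.comp_def] using this
  have hUe : ∫ x, (inner ℝ v x : ℝ) ^ 2 ∂μ = a + b := by
    have := integral_sq_sub_gaussianReal 0 (a + b)
    rw [← hμ, integral_map (by fun_prop) (by fun_prop)] at this
    simpa using this
  have hUi := integrable_comp_fst κ hU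
  have hUe' := (integral_comp_fst (μ := μ) κ (F := fun x => (inner ℝ v x : ℝ) ^ 2)
    (by fun_prop)).trans hUe
  have hWl : ∫⁻ p, ENNReal.ofReal ((inner ℝ v p.1 - inner ℝ v p.2 : ℝ) ^ 2) ∂(μ ⊗ₘ κ) = b := by
    rw [hPint (fun u z => ENNReal.ofReal ((u - inner ℝ v z : ℝ) ^ 2)) (by fun_prop)]
    simp [lintegral_sq_sub_gaussianReal]
  have hWi : Integrable (fun p : E × E => (inner ℝ v p.1 - inner ℝ v p.2 : ℝ) ^ 2) (μ ⊗ₘ κ) :=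
    ⟨by fun_prop, by
      rw [hasFiniteIntegral_iff_ofReal (ae_of_all _ fun x => sq_nonneg _), hWl]
      exact ENNReal.coe_lt_top⟩
  have hWe : ∫ p, (inner ℝ v p.1 - inner ℝ v p.2 : ℝ) ^ 2 ∂(μ ⊗ₘ κ) = b := by
    rw [integral_eq_lintegral_of_nonneg_ae (ae_of_all _ fun x => sq_nonneg _) (by fun_prop), hWl]
    simp
  refine ⟨κ, hκ, ?_, ?_⟩
  -- Pythagoras, since the output lies on the line of `v`: the error is `b` along `v` plus `T - (a +
  -- b)` across it.
  · have hrw : ∀ᵐ p ∂(μ ⊗ₘ κ), ‖p.1 - p.2‖ ^ 2 =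
        (inner ℝ v p.1 - inner ℝ v p.2 : ℝ) ^ 2 + (‖p.1‖ ^ 2 - (inner ℝ v p.1 : ℝ) ^ 2) := by
      filter_upwards [hline] with p hp
      have h1 : ‖p.2‖ ^ 2 = (inner ℝ v p.2 : ℝ) ^ 2 := by
        conv_lhs => rw [hp, norm_smul, hv]
        simp
      have h2 : (inner ℝ p.1 p.2 : ℝ) = inner ℝ v p.2 * inner ℝ v p.1 := by
        conv_lhs => rw [hp, real_inner_smul_right, real_inner_comm v]
      rw [norm_sub_sq_real, h1, h2]
      ring
    have hsub : Integrable (fun p : E × E => ‖p.1‖ ^ 2 - (inner ℝ v p.1 : ℝ) ^ 2) (μ ⊗ₘ κ) :=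
      hTi.sub hUi
    rw [distortion_eq, ← ofReal_integral_eq_lintegral_ofReal
      ((hWi.add hsub).congr (hrw.mono fun p hp => hp.symm))
      (ae_of_all _ fun p => sq_nonneg _), integral_congr_ae hrw,
      integral_add hWi hsub, integral_sub hTi hUi, hWe, hTe', hUe']
    congr 1
    ring
  · have hgi1 := hUi.div_const (2 * (a + b))
    have hgi2 := hWi.div_const (2 * b)
    have hgi0 := integrable_const (μ := μ ⊗ₘ κ) (1 / 2 * Real.log ((a + b) / b))
    have hgi01 : Integrable (fun p : E × E => 1 / 2 * Real.log ((a + b) / b) +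
        (inner ℝ v p.1 : ℝ) ^ 2 / (2 * (a + b))) (μ ⊗ₘ κ) := hgi0.add hgi1
    have ha' : (0 : ℝ) < a := ha
    have hb' : (0 : ℝ) < b := hb
    rw [mutualInfo, hsnd, klDiv_withDensity_exp hg hP (hgi01.sub hgi2)]
    congr 1
    simp only [g, logDensity]
    rw [integral_sub hgi01 hgi2, integral_add hgi0 hgi1, integral_div, integral_div,
      hUe', hWe]
    simp only [integral_const, probReal_univ, smul_eq_mul, one_mul]
    field_simp
    ring

end Bounds

end GaussianRDP

namespace GaussianRDP

/-! ### Projections, trace and eigenvectors of the Gaussian source -/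

section Covariance

open Matrix

variable {ι : Type*} [Fintype ι] [DecidableEq ι] {S : Matrix ι ι ℝ}

theorem map_inner_multivariateGaussian (hS : S.PosSemidef) (y : EuclideanSpace ℝ ι) :
    (multivariateGaussian 0 S).map (fun x => inner ℝ y x) =
      gaussianReal 0 (y.ofLp ⬝ᵥ S *ᵥ y.ofLp).toNNReal := by
  have h := IsGaussian.map_eq_gaussianReal (μ := multivariateGaussian 0 S) (innerSL ℝ y)
  have hv := covarianceBilin_self (μ := multivariateGaussian 0 S) IsGaussian.memLp_two_id y
  rw [covarianceBilin_multivariateGaussian hS] at hv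
  rw [ContinuousLinearMap.integral_comp_id_comm IsGaussian.integrable_id,
    integral_id_multivariateGaussian, map_zero] at h
  simp only [coe_innerSL_apply] at h
  rw [hv, ← h]

theorem integrable_norm_sq_multivariateGaussian :
    Integrable (fun x => ‖x‖ ^ 2) (multivariateGaussian (0 : EuclideanSpace ℝ ι) S) :=
  (IsGaussian.memLp_two_id (μ := multivariateGaussian (0 : EuclideanSpace ℝ ι) S)).norm.integrable_sq

theorem integral_norm_sq_multivariateGaussian (hS : S.PosSemidef) :
    ∫ x, ‖x‖ ^ 2 ∂(multivariateGaussian (0 : EuclideanSpace ℝ ι) S) = S.trace := by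
  have hmap : ∀ i, (multivariateGaussian (0 : EuclideanSpace ℝ ι) S).map (fun x => x i) =
      gaussianReal 0 (S i i).toNNReal := fun i => by
    simpa using (measurePreserving_eval_multivariateGaussian (μ := 0) hS (i := i)).map_eq
  have hint : ∀ i, Integrable (fun x => x i ^ 2)
      (multivariateGaussian (0 : EuclideanSpace ℝ ι) S) := fun i => by
    have := integrable_sq_sub_gaussianReal 0 0 (S i i).toNNReal
    rw [← hmap i, integrable_map_measure (by fun_prop) (by fun_prop)] at this
    simpa [Function.comp_def] using this
  simp only [EuclideanSpace.real_norm_sq_eq]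
  rw [integral_finsetSum _ fun i _ => hint i, Matrix.trace]
  refine Finset.sum_congr rfl fun i _ => ?_
  have := integral_sq_sub_gaussianReal 0 (S i i).toNNReal
  rw [← hmap i, integral_map (by fun_prop) (by fun_prop), Real.coe_toNNReal _ hS.diag_nonneg]
    at this
  simpa using this

variable {Θ : Matrix ι ι ℝ} {lam : ι → ℝ}

theorem dotProduct_mulVec_eq_sum (hdecomp : S = Θᵀ * diagonal lam * Θ) (y : ι → ℝ) :
    y ⬝ᵥ S *ᵥ y = ∑ l, lam l * (Θ *ᵥ y) l ^ 2 := by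
  rw [hdecomp, ← mulVec_mulVec, ← mulVec_mulVec, dotProduct_mulVec, vecMul_transpose, dotProduct]
  refine Finset.sum_congr rfl fun l _ => ?_
  rw [mulVec_diagonal]
  ring

theorem sum_mulVec_sq (hΘ : Θ ∈ orthogonalGroup ι ℝ) (y : ι → ℝ) :
    ∑ l, (Θ *ᵥ y) l ^ 2 = ∑ l, y l ^ 2 := by
  have h1 : Θᵀ * Θ = 1 := (mem_orthogonalGroup_iff' _ _).1 hΘ
  have : (Θ *ᵥ y) ⬝ᵥ (Θ *ᵥ y) = y ⬝ᵥ y := by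
    rw [dotProduct_mulVec, ← mulVec_transpose, mulVec_mulVec, h1, one_mulVec]
  simpa [dotProduct, sq] using this

theorem trace_eq_sum (hΘ : Θ ∈ orthogonalGroup ι ℝ) (hdecomp : S = Θᵀ * diagonal lam * Θ) :
    S.trace = ∑ l, lam l := by
  have h1 : Θ * Θᵀ = 1 := (mem_orthogonalGroup_iff _ _).1 hΘ
  rw [hdecomp, trace_mul_comm, ← mul_assoc, h1, one_mul, trace_diagonal]

theorem mulVec_transpose_single (hΘ : Θ ∈ orthogonalGroup ι ℝ) (l : ι) :
    Θ *ᵥ (Θᵀ *ᵥ Pi.single l 1) = Pi.single l 1 := by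
  have h1 : Θ * Θᵀ = 1 := (mem_orthogonalGroup_iff _ _).1 hΘ
  rw [mulVec_mulVec, h1, one_mulVec]

theorem eigenvector_dotProduct_mulVec (hΘ : Θ ∈ orthogonalGroup ι ℝ)
    (hdecomp : S = Θᵀ * diagonal lam * Θ) (l : ι) :
    (Θᵀ *ᵥ Pi.single l 1) ⬝ᵥ S *ᵥ (Θᵀ *ᵥ Pi.single l 1) = lam l := by
  rw [dotProduct_mulVec_eq_sum hdecomp, mulVec_transpose_single hΘ]
  simp [Pi.single_apply]

theorem eigenvector_norm (hΘ : Θ ∈ orthogonalGroup ι ℝ) (l : ι) :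
    ‖(WithLp.toLp 2 (Θᵀ *ᵥ Pi.single l 1) : EuclideanSpace ℝ ι)‖ = 1 := by
  have : ‖(WithLp.toLp 2 (Θᵀ *ᵥ Pi.single l 1) : EuclideanSpace ℝ ι)‖ ^ 2 = 1 := by
    rw [EuclideanSpace.real_norm_sq_eq, ← sum_mulVec_sq hΘ]
    simp [mulVec_transpose_single hΘ, -mulVec_single, Pi.single_apply]
  exact (pow_eq_one_iff_of_nonneg (norm_nonneg _) two_ne_zero).1 this

theorem eigenvalue_pos (hS : S.PosDef) (hΘ : Θ ∈ orthogonalGroup ι ℝ)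
    (hdecomp : S = Θᵀ * diagonal lam * Θ) (l : ι) : 0 < lam l := by
  rw [← eigenvector_dotProduct_mulVec hΘ hdecomp l]
  have hne : Θᵀ *ᵥ Pi.single l (1 : ℝ) ≠ 0 := fun h => by
    have := congrFun (mulVec_transpose_single hΘ l) l
    simp [h, -mulVec_single] at this
  simpa using hS.dotProduct_mulVec_pos hne

end Covariance

/-! ### The reverse water-filling equation -/

section WaterLevel

variable {L : ℕ} {lam : Fin L → ℝ}

theorem le_lamMax (lam : Fin L → ℝ) (l : Fin L) : lam l ≤ lamMax lam :=
  le_ciSup (Set.finite_range lam).bddAbove l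

theorem exists_eq_lamMax (hL : 0 < L) (lam : Fin L → ℝ) : ∃ l, lam l = lamMax lam :=
  haveI : Nonempty (Fin L) := ⟨⟨0, hL⟩⟩
  exists_eq_ciSup_of_finite

theorem mem_maxIdx {l : Fin L} : l ∈ maxIdx lam ↔ lam l = lamMax lam := by
  simp [maxIdx]

/-- A term positive at `ν'` grows strictly when the level drops. Positivity is essential: above the
largest eigenvalue the sum is constantly 0. -/
theorem sum_max_lt_of_lt {ν ν' : ℝ} (h : ν < ν') (hpos : 0 < ∑ l, max 0 (lam l - ν')) :
    ∑ l, max 0 (lam l - ν') < ∑ l, max 0 (lam l - ν) := by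
  obtain ⟨l, hl, hl'⟩ := Finset.exists_lt_of_sum_lt (s := Finset.univ) (f := fun _ => (0 : ℝ))
    (g := fun l => max 0 (lam l - ν')) (by simpa using hpos)
  refine Finset.sum_lt_sum (fun i _ => by gcongr) ⟨l, hl, ?_⟩
  have : 0 < lam l - ν' := by simpa using hl'
  exact max_lt (lt_max_of_lt_right (by linarith)) (lt_max_of_lt_right (by linarith))

theorem IsWaterLevel.unique {D ν ν' : ℝ} (hD : D < ∑ l, lam l) (h : IsWaterLevel lam D ν)
    (h' : IsWaterLevel lam D ν') : ν = ν' := by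
  have hpos : 0 < max 0 ((∑ l, lam l) - D) := lt_max_of_lt_right (by linarith)
  unfold IsWaterLevel at h h'
  rcases lt_trichotomy ν ν' with hlt | heq | hlt
  · have := sum_max_lt_of_lt hlt (h' ▸ hpos)
    rw [h, h'] at this
    exact absurd this (lt_irrefl _)
  · exact heq
  · have := sum_max_lt_of_lt hlt (h ▸ hpos)
    rw [h, h'] at this
    exact absurd this (lt_irrefl _)

/-- Under `hgap` the level lies above every non-maximal eigenvalue, so only the maximal terms
contribute, sharing `ε` equally. -/
theorem isWaterLevel_of_small (hL : 0 < L) {ε : ℝ} (hε : 0 < ε)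
    (hgap : ∀ l, l ∉ maxIdx lam → lam l < lamMax lam - ε / (maxIdx lam).card) :
    IsWaterLevel lam ((∑ l, lam l) - ε) (lamMax lam - ε / (maxIdx lam).card) := by
  have hcard : (0 : ℝ) < (maxIdx lam).card := by
    obtain ⟨l, hl⟩ := exists_eq_lamMax hL lam
    exact_mod_cast Finset.card_pos.2 ⟨l, mem_maxIdx.2 hl⟩
  have hterm : ∀ l, max 0 (lam l - (lamMax lam - ε / (maxIdx lam).card)) =
      if l ∈ maxIdx lam then ε / (maxIdx lam).card else 0 := fun l => by
    split_ifs with hl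
    · rw [mem_maxIdx.1 hl, sub_sub_cancel]
      exact max_eq_right (by positivity)
    · exact max_eq_left (by linarith [hgap l hl])
  unfold IsWaterLevel
  rw [sub_sub_cancel, max_eq_right hε.le, Finset.sum_congr rfl fun l _ => hterm l,
    Finset.sum_ite_mem, Finset.univ_inter, Finset.sum_const, nsmul_eq_mul]
  field_simp

theorem eventually_div_card_lt (lam : Fin L → ℝ) {c : ℝ} (hc : 0 < c) :
    ∀ᶠ ε : ℝ in 𝓝[>] 0, ε / (maxIdx lam).card < c := by
  have : Tendsto (fun ε : ℝ => ε / (maxIdx lam).card) (𝓝[>] 0) (𝓝 0) := by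
    have h : Continuous fun ε : ℝ => ε / ((maxIdx lam).card : ℝ) := by fun_prop
    simpa using (h.tendsto 0).mono_left nhdsWithin_le_nhds
  exact this.eventually_lt_const hc

end WaterLevel

/-! ### Two-sided bound on the rate -/

section RateBound

theorem half_log_div_sub_le {lam ε : ℝ} (hlam : 0 < lam) (h : ε ≤ lam / 2) :
    1 / 2 * Real.log (lam / (lam - ε)) - ε / (2 * lam) ≤ 1 / lam ^ 2 * ε ^ 2 := by
  have hb : 0 < lam - ε := by linarith
  have h1 := Real.log_le_sub_one_of_pos (div_pos hlam hb)
  -- The left side is `ε² / (lam (lam - ε))`, and `lam - ε ≥ lam / 2`.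
  have h2 : lam / (lam - ε) - 1 - ε / lam ≤ 2 / lam ^ 2 * ε ^ 2 := by
    have : lam / (lam - ε) - 1 - ε / lam = ε ^ 2 / (lam * (lam - ε)) := by field_simp; ring
    rw [this, div_mul_eq_mul_div, div_le_div_iff₀ (by positivity) (by positivity)]
    nlinarith [mul_nonneg (mul_nonneg (sq_nonneg ε) hlam.le) (by linarith : 0 ≤ lam - 2 * ε)]
  have h3 : ε / (2 * lam) = 1 / 2 * (ε / lam) := by field_simp
  have h4 : 1 / lam ^ 2 * ε ^ 2 = 1 / 2 * (2 / lam ^ 2 * ε ^ 2) := by ring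
  rw [h3, h4]
  linarith

variable {L : ℕ} {S Θ : Matrix (Fin L) (Fin L) ℝ} {lam : Fin L → ℝ}

open Matrix

theorem lamMax_pos (hL : 0 < L) (hS : S.PosDef) (hΘ : Θ ∈ orthogonalGroup (Fin L) ℝ)
    (hdecomp : S = Θᵀ * diagonal lam * Θ) : 0 < lamMax lam :=
  (eigenvalue_pos hS hΘ hdecomp ⟨0, hL⟩).trans_le (le_lamMax lam _)

theorem le_rdp (hL : 0 < L) (hS : S.PosDef) (hΘ : Θ ∈ orthogonalGroup (Fin L) ℝ)
    (hdecomp : S = Θᵀ * diagonal lam * Θ) (φ : Perception) (P : ℝ≥0∞) {ε : ℝ}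
    (hε : ε ≤ ∑ l, lam l) :
    ENNReal.ofReal (ε / (2 * lamMax lam)) ≤
      rdp φ (multivariateGaussian (0 : EuclideanSpace ℝ (Fin L)) S)
        (ENNReal.ofReal ((∑ l, lam l) - ε)) P := by
  refine le_iInf₂ fun κ hκ => ?_
  have := hκ.1
  have hq : ∀ y : EuclideanSpace ℝ (Fin L),
      ((y.ofLp ⬝ᵥ S *ᵥ y.ofLp).toNNReal : ℝ) ≤ lamMax lam * ‖y‖ ^ 2 := fun y => by
    rw [dotProduct_mulVec_eq_sum hdecomp, EuclideanSpace.real_norm_sq_eq, ← sum_mulVec_sq hΘ,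
      Finset.mul_sum, Real.coe_toNNReal _ (Finset.sum_nonneg fun l _ =>
        mul_nonneg (eigenvalue_pos hS hΘ hdecomp l).le (sq_nonneg _))]
    exact Finset.sum_le_sum fun l _ => mul_le_mul_of_nonneg_right (le_lamMax lam l) (sq_nonneg _)
  have h := le_mutualInfo (lamMax_pos hL hS hΘ hdecomp) (sub_nonneg.2 hε)
    (map_inner_multivariateGaussian hS.posSemidef) hq integrable_norm_sq_multivariateGaussian
    ((integral_norm_sq_multivariateGaussian hS.posSemidef).trans (trace_eq_sum hΘ hdecomp)) κ
    hκ.2.1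
  rwa [sub_sub_cancel] at h

theorem rdp_top_le (hL : 0 < L) (hS : S.PosDef) (hΘ : Θ ∈ orthogonalGroup (Fin L) ℝ)
    (hdecomp : S = Θᵀ * diagonal lam * Θ) (φ : Perception) {ε : ℝ} (hε : 0 < ε)
    (hε' : ε < lamMax lam) :
    rdp φ (multivariateGaussian (0 : EuclideanSpace ℝ (Fin L)) S)
        (ENNReal.ofReal ((∑ l, lam l) - ε)) ⊤ ≤
      ENNReal.ofReal (1 / 2 * Real.log (lamMax lam / (lamMax lam - ε))) := by
  obtain ⟨l, hl⟩ := exists_eq_lamMax hL lam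
  lift ε to NNReal using hε.le
  obtain ⟨b, hb⟩ : ∃ b : NNReal, (b : ℝ) = lamMax lam - ε := ⟨⟨_, (sub_pos.2 hε').le⟩, rfl⟩
  have hsum : (ε : ℝ) + b = lamMax lam := by rw [hb]; ring
  have hmap := map_inner_multivariateGaussian hS.posSemidef
    (WithLp.toLp 2 (Θᵀ *ᵥ Pi.single l 1))
  rw [eigenvector_dotProduct_mulVec hΘ hdecomp, hl, ← hsum, ← NNReal.coe_add,
    Real.toNNReal_coe] at hmap
  have hbpos : 0 < b := by
    rw [← NNReal.coe_pos, hb]; linarith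
  obtain ⟨κ, hκ, hd, hI⟩ := exists_kernel_mutualInfo_eq (eigenvector_norm hΘ l)
    (NNReal.coe_pos.1 hε) hbpos hmap integrable_norm_sq_multivariateGaussian
    ((integral_norm_sq_multivariateGaussian hS.posSemidef).trans (trace_eq_sum hΘ hdecomp))
  rw [hsum, hb] at hI
  -- With `P = ⊤` the perception constraint is vacuous for either loss.
  exact (iInf₂_le κ ⟨hκ, hd.le, le_top⟩).trans hI.le

end RateBound

end GaussianRDP

/-! ### The main theorem -/

theorem proposition1 {L : ℕ} (hL : 0 < L)
    (S : Matrix (Fin L) (Fin L) ℝ) (hS : S.PosDef)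
    (Θ : Matrix (Fin L) (Fin L) ℝ) (hΘ : Θ ∈ Matrix.orthogonalGroup (Fin L) ℝ)
    (lam : Fin L → ℝ) (hdecomp : S = Θ.transpose * Matrix.diagonal lam * Θ)
    (φ : GaussianRDP.Perception) :
    -- the rate is finite for small `ε > 0`, and equals `ε / (2 λmax) + O(ε²)`
    (∀ᶠ ε : ℝ in 𝓝[>] 0,
      GaussianRDP.rdp φ (multivariateGaussian (0 : EuclideanSpace ℝ (Fin L)) S)
        (ENNReal.ofReal ((∑ l, lam l) - ε)) ⊤ ≠ ⊤) ∧
    ((fun ε : ℝ =>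
      (GaussianRDP.rdp φ (multivariateGaussian (0 : EuclideanSpace ℝ (Fin L)) S)
        (ENNReal.ofReal ((∑ l, lam l) - ε)) ⊤).toReal - ε / (2 * GaussianRDP.lamMax lam))
      =O[𝓝[>] 0] fun ε : ℝ => ε ^ 2) ∧
    -- for small `ε > 0` the water level is well defined, and the component levels are as claimed
    (∀ᶠ ε : ℝ in 𝓝[>] 0,
      (∃! ν : ℝ, GaussianRDP.IsWaterLevel lam ((∑ l, lam l) - ε) ν) ∧
      ∀ ν : ℝ, GaussianRDP.IsWaterLevel lam ((∑ l, lam l) - ε) ν →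
        (∀ l, l ∉ GaussianRDP.maxIdx lam →
          GaussianRDP.compLevel (lam l) ν = lam l ∧
          GaussianRDP.compRate (lam l) (GaussianRDP.compLevel (lam l) ν) = 0) ∧
        (∀ l, l ∈ GaussianRDP.maxIdx lam →
          GaussianRDP.compLevel (lam l) ν =
            GaussianRDP.lamMax lam - ε / ((GaussianRDP.maxIdx lam).card : ℝ) ∧
          0 < GaussianRDP.compRate (lam l) (GaussianRDP.compLevel (lam l) ν))) := by
  open GaussianRDP in
  have hmax := lamMax_pos hL hS hΘ hdecomp
  -- Keeps `∑ λ - ε` nonnegative for small `ε`, so that `ENNReal.ofReal` does not truncate the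
  -- distortion.
  have hmaxsum : lamMax lam ≤ ∑ l, lam l := by
    obtain ⟨l, hl⟩ := exists_eq_lamMax hL lam
    rw [← hl]
    exact Finset.single_le_sum (fun i _ => (eigenvalue_pos hS hΘ hdecomp i).le)
      (Finset.mem_univ l)
  have hsmall : ∀ᶠ ε : ℝ in 𝓝[>] 0, 0 < ε ∧ ε ≤ lamMax lam / 2 := by
    filter_upwards [Ioc_mem_nhdsGT (half_pos hmax)] with ε hε using hε
  refine ⟨?_, ?_, ?_⟩
  · filter_upwards [hsmall] with ε hε
    exact ne_top_of_le_ne_top ENNReal.ofReal_ne_top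
      (rdp_top_le hL hS hΘ hdecomp φ hε.1 (by linarith [hε.2]))
  · refine IsBigO.of_bound (1 / lamMax lam ^ 2) ?_
    filter_upwards [hsmall] with ε ⟨hε, hε'⟩
    have hlow := le_rdp hL hS hΘ hdecomp φ ⊤ (ε := ε) (by linarith)
    have hup := rdp_top_le hL hS hΘ hdecomp φ hε (by linarith)
    have hlow' := (ENNReal.ofReal_le_iff_le_toReal
      (ne_top_of_le_ne_top ENNReal.ofReal_ne_top hup)).1 hlow
    have hup' := ENNReal.toReal_le_of_le_ofReal (mul_nonneg (by norm_num) (Real.log_nonneg (by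
      rw [le_div_iff₀ (by linarith)]; linarith))) hup
    rw [Real.norm_of_nonneg (sub_nonneg.2 hlow'), Real.norm_of_nonneg (sq_nonneg ε)]
    exact (sub_le_sub_right hup' _).trans (half_log_div_sub_le hmax hε')
  · have hgap : ∀ᶠ ε : ℝ in 𝓝[>] 0, ∀ l, l ∉ maxIdx lam →
        lam l < lamMax lam - ε / (maxIdx lam).card := by
      refine eventually_all.2 fun l => ?_
      by_cases hl : l ∈ maxIdx lam
      · exact Eventually.of_forall fun _ h => absurd hl h
      · have hlt : lam l < lamMax lam :=
          lt_of_le_of_ne (le_lamMax lam l) fun h => hl (mem_maxIdx.2 h)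
        filter_upwards [eventually_div_card_lt lam (sub_pos.2 hlt)] with ε hε _
        linarith
    -- The last condition keeps the water level positive, as the sign of the logarithmic rate
    -- requires.
    filter_upwards [hsmall, hgap, eventually_div_card_lt lam hmax] with ε ⟨hε, _⟩ hg hc
    have hw := isWaterLevel_of_small hL hε hg
    have huniq : ∀ ν, IsWaterLevel lam ((∑ l, lam l) - ε) ν →
        ν = lamMax lam - ε / (maxIdx lam).card := fun ν hν => hν.unique (by linarith) hw
    refine ⟨⟨_, hw, huniq⟩, fun ν hν => ?_⟩
    rw [huniq ν hν]
    refine ⟨fun l hl => ?_, fun l hl => ?_⟩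
    · have hlev : compLevel (lam l) (lamMax lam - ε / (maxIdx lam).card) = lam l :=
        if_pos (hg l hl).le
      refine ⟨hlev, ?_⟩
      rw [hlev, compRate, div_self (eigenvalue_pos hS hΘ hdecomp l).ne', Real.log_one, mul_zero]
    · have hpos : 0 < ε / ((maxIdx lam).card : ℝ) :=
        div_pos hε (by exact_mod_cast Finset.card_pos.2 ⟨l, hl⟩)
      have hlev : compLevel (lam l) (lamMax lam - ε / (maxIdx lam).card) =
          lamMax lam - ε / (maxIdx lam).card :=
        if_neg (by rw [mem_maxIdx.1 hl]; linarith)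
      refine ⟨hlev, ?_⟩
      rw [hlev, compRate, mem_maxIdx.1 hl]
      refine mul_pos (by norm_num) (Real.log_pos ?_)
      rw [one_lt_div (by linarith)]
      linarith
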